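/- Define the relation $\alpha <_1 \beta$ on ordinals by recursion on $\beta$: $\alpha <_1 \beta$ iff $\alpha<\beta$ and for every finite $Z\subseteq\beta$ there is a map $h\colon Z\to\alpha$ with $h(z)=z$ for all $z\in Z\cap\alpha$ which is an isomorphism onto its image for $<$, $<_1$ and (the graph of) $+$, i.e. for all $x,y,z\in Z$: $x<y\iff h(x)<h(y)$, $x<_1y\iff h(x)<_1h(y)$, and $x+y=z\iff h(x)+h(y)=h(z)$. Write $\alpha\leqslant_1\beta$ for $\alpha=\beta$ or $\alpha<_1\beta$. Let $m(\alpha)=\max\{\xi : \alpha\leqslant_1\xi\}$ if this class is bounded, and $m(\alpha)=\infty$ otherwise, where $\infty$ is larger than every ordinal. Let $\mathrm{Class}(1)$ be the class of epsilon numbers (ordinals $\alpha$ with $\omega^\alpha=\alpha$). For $n\geqslant 1$ and $\alpha\in\mathrm{Class}(n)$ let $\alpha(+^n)$ be the least element of $\mathrm{Class}(n)$ greater than $\alpha$, or $\infty$ if there is none, and let $\mathrm{Class}(n+1)$ consist of all $\alpha\in\mathrm{Class}(n)$ such that $\alpha(+^n)\in\mathrm{Class}(n)$ and $\alpha<_1\alpha(+^n)$.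 For $k\geqslant1$, $\alpha\in\mathrm{Class}(k)$ and $t\in[\alpha,\alpha(+^k))$ put $\beta:=\bigl(\alpha(+^{k-1})(+^{k-2})\cdots(+^1)\bigr)\cdot2$ (so $\beta=\alpha\cdot 2$ if $k=1$), and define the ordinal $$\eta(k,\alpha,t):=\begin{cases}\beta & \text{if } t\in[\alpha,\beta],\\ \max\{m(e) : e\in(\alpha,t]\} & \text{if } t>\beta.\end{cases}$$ **Proposition.** Let $k\geqslant 1$ be an integer, $\alpha\in\mathrm{Class}(k)$, $t\in(\alpha,\alpha(+^k))$ and $P:=\{r\in(\alpha,t] : m(r)\geqslant t\}$. Then (0) $P$ is finite, and $1\leqslant|P|\leqslant k+1$. (1) $\max\{m(e) : e\in P\}$ and $\max\{m(e) : e\in(\alpha,t]\}$ exist, are ordinals (not $\infty$), and are equal. (2) $\eta(k,\alpha,t)$ is well defined: the successors occurring in $\beta$ are all defined and are ordinals, the maximum exists and is an ordinal when $t>\beta$, and so there is exactly one ordinal that is the value $\eta(k,\alpha,t)$. (3) $\eta(k,\alpha,t)\geqslant m(t)\geqslant t$. -/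

import Mathlib

universe u

namespace Carlson

open Ordinal

/-- The relation `α <₁ β`, by recursion on `β`: `α < β`, and every finite `Z ⊆ β` has a
`(<, <₁, +)`-isomorphism `h` onto a finite subset of `α` that fixes the elements of `Z ∩ α`.
Addition is treated as a partial operation on `Z`, that is, through its graph. Equivalently: `α`
with the restrictions of `<`, `<₁`, `+` is a `Σ₁`-elementary substructure of `β`.
The recursive formula is `lt1_iff` below. -/
def Lt1 (α β : Ordinal.{u}) : Prop :=
  ∃ _ : α < β, ∀ Z : Finset Ordinal.{u}, ∀ _ : (∀ z ∈ Z, z < β),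
    ∃ h : Ordinal.{u} → Ordinal.{u}, ∃ _ : (∀ z ∈ Z, h z < α),
      (∀ z ∈ Z, z < α → h z = z) ∧
      (∀ x ∈ Z, ∀ y ∈ Z, (x < y ↔ h x < h y)) ∧
      (∀ x ∈ Z, ∀ y ∈ Z, ∀ z ∈ Z, (x + y = z ↔ h x + h y = h z)) ∧
      (∀ x ∈ Z, ∀ y, ∀ _ : y ∈ Z, (Lt1 x y ↔ Lt1 (h x) (h y)))
termination_by β
decreasing_by
  · have hZ : ∀ z ∈ Z, z < β := by assumption
    exact hZ y (by assumption)
  · have hh : ∀ z ∈ Z, h z < α := by assumption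
    exact (hh y (by assumption)).trans (by assumption)

theorem lt1_iff (α β : Ordinal.{u}) :
    Lt1 α β ↔ α < β ∧ ∀ Z : Finset Ordinal.{u}, (∀ z ∈ Z, z < β) →
      ∃ h : Ordinal.{u} → Ordinal.{u}, (∀ z ∈ Z, h z < α) ∧
        (∀ z ∈ Z, z < α → h z = z) ∧
        (∀ x ∈ Z, ∀ y ∈ Z, (x < y ↔ h x < h y)) ∧
        (∀ x ∈ Z, ∀ y ∈ Z, ∀ z ∈ Z, (x + y = z ↔ h x + h y = h z)) ∧
        (∀ x ∈ Z, ∀ y ∈ Z, (Lt1 x y ↔ Lt1 (h x) (h y))) := by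
  rw [Lt1]
  simp only [exists_prop]

/-- `α ≤₁ β`. -/
def Le1 (α β : Ordinal.{u}) : Prop := α = β ∨ Lt1 α β

open Classical in
/-- `m(α)`: the maximum of `{ξ | α ≤₁ ξ}` if this class is bounded, and `∞` (written `⊤`)
otherwise, that is, if `α ≤₁ ξ` for all `ξ ≥ α`. The maximum exists by `isGreatest_m`. -/
noncomputable def m (α : Ordinal.{u}) : WithTop Ordinal.{u} :=
  if BddAbove {ξ | Le1 α ξ} then ((sSup {ξ | Le1 α ξ} : Ordinal.{u}) : WithTop Ordinal.{u}) else ⊤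

theorem Lt1.mono {α β γ : Ordinal.{u}} (h : Lt1 α γ) (h1 : α < β) (h2 : β ≤ γ) : Lt1 α β := by
  rw [lt1_iff] at h ⊢
  exact ⟨h1, fun Z hZ => h.2 Z fun z hz => (hZ z hz).trans_le h2⟩

theorem isGreatest_m (α : Ordinal.{u}) (hb : BddAbove {ξ | Le1 α ξ}) :
    ∃ μ : Ordinal.{u}, m α = μ ∧ IsGreatest {ξ | Le1 α ξ} μ := by
  refine ⟨sSup {ξ | Le1 α ξ}, by simp [m, hb], ?_, fun ξ hξ => le_csSup hb hξ⟩
  have hne : α ∈ {ξ | Le1 α ξ} := Or.inl rfl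
  by_contra hcon
  have hlt : ∀ z < sSup {ξ | Le1 α ξ}, ∃ ξ ∈ {ξ | Le1 α ξ}, z < ξ :=
    fun z hz => exists_lt_of_lt_csSup ⟨α, hne⟩ hz
  have hα : α < sSup {ξ | Le1 α ξ} :=
    lt_of_le_of_ne (le_csSup hb hne) fun e => hcon (Or.inl e)
  refine hcon (Or.inr ?_)
  rw [lt1_iff]
  refine ⟨hα, fun Z hZ => ?_⟩
  obtain ⟨ξ, hξ, hZξ⟩ : ∃ ξ ∈ {ξ | Le1 α ξ}, (∀ z ∈ Z, z < ξ) ∧ α < ξ := by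
    rcases Z.eq_empty_or_nonempty with rfl | hZn
    · obtain ⟨ξ, h1, h2⟩ := hlt _ hα
      exact ⟨ξ, h1, by simp, h2⟩
    · obtain ⟨ξ, h1, h2⟩ := hlt (max α (Z.max' hZn)) (max_lt hα (hZ _ (Z.max'_mem hZn)))
      exact ⟨ξ, h1, fun z hz => (Z.le_max' z hz).trans_lt ((le_max_right _ _).trans_lt h2),
        (le_max_left _ _).trans_lt h2⟩
  rcases hξ with rfl | hξ
  · exact absurd hZξ.2 (lt_irrefl _)
  · exact ((lt1_iff _ _).1 hξ).2 Z hZξ.1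

open Classical in
/-- The least element of `C` above `α`, or `∞` (written `⊤`) if there is none. -/
noncomputable def next (C : Set Ordinal.{u}) (α : Ordinal.{u}) : WithTop Ordinal.{u} :=
  if {β ∈ C | α < β}.Nonempty then ((sInf {β ∈ C | α < β} : Ordinal.{u}) : WithTop Ordinal.{u})
  else ⊤

/-- `Cl n` is `Class(n)`, for `n ≥ 1`: `Class(1)` consists of the epsilon numbers, and
`Class(n+1)` of the `α ∈ Class(n)` with `α(+ⁿ) ∈ Class(n)` (so `α(+ⁿ) ≠ ∞`) and `α <₁ α(+ⁿ)`.
The value at `n = 0` is not used. -/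
def Cl : ℕ → Set Ordinal.{u}
  | 0 => ∅
  | 1 => {α | ω ^ α = α}
  | n + 2 => {α | α ∈ Cl (n + 1) ∧
      ∃ β : Ordinal.{u}, next (Cl (n + 1)) α = β ∧ β ∈ Cl (n + 1) ∧ Lt1 α β}

/-- `plus n α` is `α(+ⁿ)`, the successor of `α` in `Class(n)`, for `α ∈ Class(n)`. -/
noncomputable def plus (n : ℕ) (α : Ordinal.{u}) : WithTop Ordinal.{u} := next (Cl n) α

/-- `IsTower n α β` says that `α(+ⁿ)(+ⁿ⁻¹)⋯(+¹)` is defined, with value the ordinal `β`: each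
`(+ⁱ)` is applied to an ordinal in `Class(i)`, and has an ordinal (not `∞`) as its value.
For `n = 0` the value is `α`. -/
def IsTower : ℕ → Ordinal.{u} → Ordinal.{u} → Prop
  | 0, α, β => β = α
  | n + 1, α, β => α ∈ Cl (n + 1) ∧ ∃ γ : Ordinal.{u}, plus (n + 1) α = γ ∧ IsTower n γ β

/-- `IsEta k α t v` says that `η(k, α, t)` is defined, with value the ordinal `v`, for `k ≥ 1`,
`α ∈ Class(k)` and `t ∈ [α, α(+ᵏ))`: with `β = α(+ᵏ⁻¹)⋯(+¹)2`, the value is `β` if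
`t ∈ [α, β]`, and `max {m(e) | e ∈ (α, t]}` if `t > β`. -/
def IsEta (k : ℕ) (α t v : Ordinal.{u}) : Prop :=
  ∃ γ : Ordinal.{u}, IsTower (k - 1) α γ ∧
    ((t ≤ γ * 2 ∧ v = γ * 2) ∨
      (γ * 2 < t ∧ IsGreatest (m '' Set.Ioc α t) (v : WithTop Ordinal.{u})))

/-- The set `P = {r ∈ (α, t] | m(r) ≥ t}`. -/
def P (α t : Ordinal.{u}) : Set Ordinal.{u} :=
  {r | r ∈ Set.Ioc α t ∧ (t : WithTop Ordinal.{u}) ≤ m r}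

end Carlson

namespace Carlson

open Ordinal Order

/-! The set `P` is a `<₁`-chain, and each step down from its top improves the element: below
something it is additively principal (`Lt1.isPrincipal`), below a principal ordinal it is an epsilon
number (`mem_Cl_one_of_lt1`), below an element of Class(n) it lies in Class(n+1) (`mem_Cl_of_lt1`).
So k+2 elements of `P` would put the least one in Class(k), inside (α, t], against t < α(+ᵏ).

Every class is unbounded (`exists_gt_mem_Cl`, a closing-off argument), so m(r) = ∞ would likewise
put r in Class(k). The maximum of m over the finite set `P` is at least t, while m < t on the rest
of (α, t]; hence the two maxima agree.

For t ≤ β = γ·2, the bound m(t) ≤ β is `IsTower.not_lt1`. It rests on the fact that a is an epsilon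
number iff a <₁ a·2: membership of a tower element in its class is then witnessed by finitely many
ordinals ≤ γ·2, and would reflect below t. -/

/-! ### Basic properties of `<₁` -/

theorem Lt1.lt {a b : Ordinal.{u}} (h : Lt1 a b) : a < b := ((lt1_iff a b).1 h).1

theorem Lt1.trans {a b c : Ordinal.{u}} (hab : Lt1 a b) (hbc : Lt1 b c) : Lt1 a c := by
  classical
  have hlt := hab.lt
  rw [lt1_iff] at hab hbc ⊢
  refine ⟨hab.1.trans hbc.1, fun Z hZ => ?_⟩
  obtain ⟨f, f1, f2, f3, f4, f5⟩ := hbc.2 Z hZ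
  obtain ⟨g, g1, g2, g3, g4, g5⟩ := hab.2 (Z.image f) (by simpa using f1)
  have hm : ∀ z ∈ Z, f z ∈ Z.image f := fun z hz => Finset.mem_image_of_mem f hz
  refine ⟨fun z => g (f z), fun z hz => g1 _ (hm z hz), fun z hz hza => ?_,
    fun x hx y hy => (f3 x hx y hy).trans (g3 _ (hm x hx) _ (hm y hy)),
    fun x hx y hy z hz => (f4 x hx y hy z hz).trans (g4 _ (hm x hx) _ (hm y hy) _ (hm z hz)),
    fun x hx y hy => (f5 x hx y hy).trans (g5 _ (hm x hx) _ (hm y hy))⟩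
  have hfz := f2 z hz (hza.trans hlt)
  have := g2 (f z) (hm z hz) (by rwa [hfz])
  simpa [hfz] using this

theorem Lt1.isPrincipal {a b : Ordinal.{u}} (h : Lt1 a b) : IsPrincipal (· + ·) a := by
  classical
  rw [isPrincipal_add_iff_add_lt_ne_self]
  intro x hx y hy hxy
  rw [lt1_iff] at h
  obtain ⟨f, f1, f2, f3, f4, f5⟩ := h.2 {x, y, a} (by
    intro z hz
    simp only [Finset.mem_insert, Finset.mem_singleton] at hz
    rcases hz with rfl | rfl | rfl
    · exact hx.trans h.1
    · exact hy.trans h.1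
    · exact h.1)
  have h1 := f2 x (by simp) hx
  have h2 := f2 y (by simp) hy
  have h3 := (f4 x (by simp) y (by simp) a (by simp)).1 hxy
  rw [h1, h2, hxy] at h3
  exact (f1 a (by simp)).ne h3.symm

theorem Lt1.one_lt {a b : Ordinal.{u}} (h : Lt1 a b) : 1 < a := by
  classical
  by_contra hle
  rw [lt1_iff] at h
  obtain ⟨f, f1, f2, f3, f4, f5⟩ := h.2 {0, a} (by
    intro z hz
    simp only [Finset.mem_insert, Finset.mem_singleton] at hz
    rcases hz with rfl | rfl
    · exact (zero_le).trans_lt h.1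
    · exact h.1)
  have ha := f1 a (by simp)
  have ha1 : f a < 1 := ha.trans_le (not_lt.1 hle)
  have hfa : f a = 0 := Order.lt_one_iff.1 ha1
  have h0 : (0 : Ordinal.{u}) < a := by rwa [hfa] at ha
  have := (f3 0 (by simp) a (by simp)).1 h0
  rw [hfa] at this
  exact not_lt_zero this

theorem Lt1.exists_opow {a b : Ordinal.{u}} (h : Lt1 a b) : ∃ d : Ordinal.{u}, d ≠ 0 ∧ a = ω ^ d := by
  rcases isPrincipal_add_iff_zero_or_omega0_opow.1 h.isPrincipal with rfl | ⟨d, rfl⟩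
  · exact absurd h.one_lt (by simp)
  · refine ⟨d, ?_, rfl⟩
    rintro rfl
    simpa using h.one_lt

/-! ### Epsilon numbers as the ordinals a with a <₁ a + a -/

theorem opow_succ_dvd_of_exists {x d : Ordinal.{u}}
    (h : ∀ r < d, ∃ e, r < e ∧ e < d ∧ ω ^ x ∣ e) : ω ^ (x + 1) ∣ d := by
  have hb : (ω ^ x : Ordinal.{u}) ≠ 0 := (opow_pos _ omega0_pos).ne'
  have hbp : (0 : Ordinal.{u}) < ω ^ x := opow_pos _ omega0_pos
  have hd : (ω ^ x : Ordinal.{u}) ∣ d := by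
    by_contra hnd
    have h1 : ω ^ x * (d / ω ^ x) < d := lt_of_le_of_ne (mul_div_le d _) fun e => hnd ⟨_, e.symm⟩
    obtain ⟨e, he, hed, c, rfl⟩ := h _ h1
    have h2 := lt_mul_div_add d hb
    rw [← mul_add_one] at h2
    have h3 : d / ω ^ x < c := lt_of_mul_lt_mul_left' he
    have h4 : c < d / ω ^ x + 1 := lt_of_mul_lt_mul_left' (hed.trans h2)
    exact (Order.lt_add_one_iff.1 h4).not_gt h3
  obtain ⟨c, rfl⟩ := hd
  rw [opow_add, opow_one]
  refine mul_dvd_mul_left _ (isSuccPrelimit_iff_omega0_dvd.1 ?_)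
  intro y hy
  obtain rfl : y + 1 = c := Order.covBy_iff_add_one_eq.1 hy
  obtain ⟨e, he, hed, c, rfl⟩ := h _ (mul_lt_mul_of_pos_left (lt_add_one y) hbp)
  have h3 : y < c := lt_of_mul_lt_mul_left' he
  have h4 : c < y + 1 := lt_of_mul_lt_mul_left' hed
  exact (Order.lt_add_one_iff.1 h4).not_gt h3

theorem opow_dvd_of_isSuccLimit {x d : Ordinal.{u}} (hx : IsSuccLimit x)
    (h : ∀ y < x, ω ^ y ∣ d) : ω ^ x ∣ d := by
  rw [dvd_iff_mod_eq_zero]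
  by_contra hr
  have hlt : d % ω ^ x < ω ^ x := mod_lt _ (opow_pos _ omega0_pos).ne'
  obtain ⟨y, hy, hlt'⟩ := (lt_opow_of_isSuccLimit omega0_ne_zero hx).1 hlt
  have h1 : ω ^ y ∣ ω ^ x * (d / ω ^ x) := (opow_dvd_opow _ hy.le).trans (dvd_mul_right _ _)
  have h2 : ω ^ y ∣ d % ω ^ x := by
    rw [← dvd_add_iff h1, div_add_mod]
    exact h y hy
  exact (le_of_dvd hr h2).not_gt hlt'

/-- Induction on x. At x + 1, reflecting the pair ω^d <₁ ω^d + x below ω^d gives exponents e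
arbitrarily close to d with ω^e <₁ ω^e + x, to which the induction hypothesis applies. -/
theorem opow_dvd_of_lt1 (x : Ordinal.{u}) : ∀ d : Ordinal.{u}, x ≤ ω ^ d →
    Lt1 (ω ^ d) (ω ^ d + x) → ω ^ x ∣ d := by
  classical
  induction x using Ordinal.limitRecOn with
  | zero => intro d _ _; simp
  | limit x hx ih =>
    intro d hxd h
    refine opow_dvd_of_isSuccLimit hx fun y hy => ?_
    rcases eq_or_ne y 0 with rfl | hy0
    · simp
    refine ih y hy d (hy.le.trans hxd) (h.mono ?_ (by gcongr))
    simpa using pos_iff_ne_zero.2 hy0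
  | add_one x ih =>
    intro d hxd h
    have hx : x < ω ^ d := Order.add_one_le_iff.1 hxd
    refine opow_succ_dvd_of_exists fun r hr => ?_
    have hrd : ω ^ r < ω ^ d := (opow_lt_opow_iff_right one_lt_omega0).2 hr
    have hlt : ω ^ d + x < ω ^ d + (x + 1) := by gcongr; exact lt_add_one x
    have hle : ω ^ d ≤ ω ^ d + x := le_self_add
    have hprinc := h.isPrincipal
    have hl := h
    rw [lt1_iff] at hl
    obtain ⟨f, f1, f2, f3, f4, f5⟩ := hl.2 {ω ^ r, x, ω ^ d, ω ^ d + x} (by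
      intro z hz
      simp only [Finset.mem_insert, Finset.mem_singleton] at hz
      rcases hz with rfl | rfl | rfl | rfl
      · exact hrd.trans (hle.trans_lt hlt)
      · exact hx.trans (hle.trans_lt hlt)
      · exact hle.trans_lt hlt
      · exact hlt)
    have hr' := f2 (ω ^ r) (by simp) hrd
    have hx' := f2 x (by simp) hx
    have hxa : x < f (ω ^ d) := by
      have := (f3 x (by simp) (ω ^ d) (by simp)).1 hx
      rwa [hx'] at this
    have hsum := (f4 (ω ^ d) (by simp) x (by simp) (ω ^ d + x) (by simp)).1 rfl
    rw [hx'] at hsum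
    -- Absorption of ω^r is preserved by `f`; it forces the image of ω^d up to at least ω^(r+1).
    have hra : ω ^ r + f (ω ^ d) = f (ω ^ d) := by
      have := (f4 (ω ^ r) (by simp) (ω ^ d) (by simp) (ω ^ d) (by simp)).1
        (hprinc.add_eq_right hrd)
      rwa [hr'] at this
    have hfd := f1 (ω ^ d) (by simp)
    have hrf : ω ^ (r + 1) ≤ f (ω ^ d) := by
      by_contra hc
      have := add_eq_right_iff_mul_omega0_le.1 hra
      rw [← opow_one ω, ← opow_mul, ← opow_add] at this
      exact hc (by simpa using this)
    -- For x = 0 there is no strict relation to reflect, but divisibility by ω^0 is trivial.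
    rcases eq_or_ne x 0 with rfl | hx0
    · exact ⟨r + 1, lt_add_one r, (opow_lt_opow_iff_right one_lt_omega0).1 (hrf.trans_lt hfd),
        by simp⟩
    have hL : Lt1 (ω ^ d) (ω ^ d + x) :=
      h.mono (by simpa using pos_iff_ne_zero.2 hx0) hlt.le
    have hL' := (f5 (ω ^ d) (by simp) (ω ^ d + x) (by simp)).1 hL
    rw [← hsum] at hL'
    obtain ⟨e, he0, he⟩ := hL'.exists_opow
    rw [he] at hL' hxa hrf hfd
    exact ⟨e, (lt_add_one r).trans_le ((opow_le_opow_iff_right one_lt_omega0).1 hrf),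
      (opow_lt_opow_iff_right one_lt_omega0).1 hfd, ih e hxa.le hL'⟩

theorem mem_Cl_one_of_lt1_add_self {a : Ordinal.{u}} (h : Lt1 a (a + a)) : a ∈ Cl.{u} 1 := by
  obtain ⟨d, hd, rfl⟩ := h.exists_opow
  have h1 := le_of_dvd hd (opow_dvd_of_lt1 _ d le_rfl h)
  have h2 : d ≤ ω ^ d := right_le_opow d one_lt_omega0
  have h3 : ω ^ d ≤ ω ^ ω ^ d := right_le_opow _ one_lt_omega0
  have : d = ω ^ d := le_antisymm h2 (h3.trans h1)
  change ω ^ ω ^ d = ω ^ d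
  rw [← this]
  exact this.symm

/-- If x <₁ a fails, then m(x) < a serves as the bound; past it, x is `<₁`-below nothing. -/
theorem exists_bound_lt1 {x a : Ordinal.{u}} (hx : x < a) :
    ∃ b < a, x ≤ b ∧ ∀ y, Lt1 x y → Lt1 x a ∨ y ≤ b := by
  by_cases h : Lt1 x a
  · exact ⟨x, hx, le_rfl, fun _ _ => Or.inl h⟩
  have hub : a ∈ upperBounds {ξ | Le1 x ξ} := by
    rintro ξ (rfl | hξ)
    · exact hx.le
    · by_contra hc
      exact h (hξ.mono hx (not_le.1 hc).le)
  obtain ⟨μ, -, hμ, hμ'⟩ := isGreatest_m x ⟨a, hub⟩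
  refine ⟨μ, lt_of_le_of_ne (hub hμ) ?_, hμ' (Or.inl rfl), fun y hy => Or.inr (hμ' (Or.inr hy))⟩
  rintro rfl
  rcases hμ with rfl | hμ
  · exact hx.ne rfl
  · exact h hμ

theorem exists_opow_dvd_between {x d r : Ordinal.{u}} (h : ω ^ (x + 1) ∣ d) (hr : r < d) :
    ∃ e, r < e ∧ e < d ∧ ω ^ x ∣ e := by
  have hb : (0 : Ordinal.{u}) < ω ^ x := opow_pos _ omega0_pos
  obtain ⟨c, rfl⟩ := h
  rw [opow_add, opow_one, mul_assoc] at *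
  refine ⟨ω ^ x * (r / ω ^ x + 1), ?_, ?_, dvd_mul_right _ _⟩
  · rw [mul_add_one]
    exact lt_mul_div_add r hb.ne'
  · refine mul_lt_mul_of_pos_left ?_ hb
    have h1 := (lt_mul_iff_div_lt hb.ne').1 hr
    exact (isSuccPrelimit_iff_omega0_dvd.2 (dvd_mul_right ω c)).add_one_lt h1

theorem not_lt1_add {a x y : Ordinal.{u}} (hx : x ≠ 0) (hxa : x < a) : ¬ Lt1 (a + x) y := by
  intro h
  have hlt : a < a + x := by simpa using pos_iff_ne_zero.2 hx
  exact (h.isPrincipal hlt (hxa.trans hlt)).ne rfl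

/-- A finite Z is moved by fixing what lies below a = ω^d and sending a + y to r + y, where r = ω^e
< a exceeds all relevant bounds and ω^M divides e, with M bounding the offsets y. By induction a <₁
a + y and r <₁ r + y for 0 < y ≤ M, while a + y and r + y with y ≠ 0 are not principal and so are
`<₁`-below nothing. -/
theorem lt1_of_opow_dvd (x : Ordinal.{u}) : ∀ d : Ordinal.{u}, d ≠ 0 → x ≠ 0 → x ≤ ω ^ d →
    ω ^ x ∣ d → Lt1 (ω ^ d) (ω ^ d + x) := by
  classical
  induction x using WellFoundedLT.induction with
  | ind x ih =>
  intro d hd hx hxd hdvd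
  have hpa : IsPrincipal (· + ·) (ω ^ d) := isPrincipal_add_omega0_opow d
  have hx0 : 0 < x := pos_iff_ne_zero.2 hx
  have ha0 : (0 : Ordinal.{u}) < ω ^ d := opow_pos _ omega0_pos
  rw [lt1_iff]
  refine ⟨by simpa using hx0, fun Z hZ => ?_⟩
  obtain ⟨M, hMx, hM⟩ : ∃ M < x, ∀ z ∈ Z, z - ω ^ d ≤ M := by
    refine ⟨Z.sup fun z => z - ω ^ d, ?_, fun z hz => Finset.le_sup (f := fun z => z - ω ^ d) hz⟩
    rw [Finset.sup_lt_iff (by simpa using hx0)]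
    intro z hz
    exact sub_lt_of_lt_add (hZ z hz) hx0
  choose! b hb1 hb2 hb3 using fun (z : Ordinal.{u}) (hz : z < ω ^ d) => exists_bound_lt1 hz
  obtain ⟨B, hBa, hMB, hB⟩ : ∃ B < ω ^ d, M ≤ B ∧ ∀ z ∈ Z, z < ω ^ d → b z ≤ B := by
    refine ⟨max M (Z.sup fun z => if z < ω ^ d then b z else 0), ?_, le_max_left _ _,
      fun z hz hza => ?_⟩
    · refine max_lt (hMx.trans_le hxd) ?_
      rw [Finset.sup_lt_iff (by simpa using ha0)]
      intro z hz
      split_ifs with hza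
      · exact hb1 z hza
      · exact ha0
    · have := Finset.le_sup (f := fun z => if z < ω ^ d then b z else 0) hz
      exact (by simpa [hza] using this : b z ≤ _).trans (le_max_right _ _)
  have hdM : ω ^ (M + 1) ∣ d := (opow_dvd_opow _ (Order.add_one_le_iff.2 hMx)).trans hdvd
  have hdlim : IsSuccLimit d := by
    rw [Ordinal.isSuccLimit_iff, isSuccPrelimit_iff_omega0_dvd]
    refine ⟨by simpa using hd, ?_⟩
    have : (ω : Ordinal.{u}) ^ (1 : Ordinal.{u}) ∣ ω ^ x := opow_dvd_opow _ (Order.one_le_iff_pos.2 hx0)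
    rw [opow_one] at this
    exact this.trans hdvd
  obtain ⟨s, hsd, hBs⟩ := (lt_opow_of_isSuccLimit omega0_ne_zero hdlim).1 hBa
  obtain ⟨e, hse, hed, hdvde⟩ := exists_opow_dvd_between hdM hsd
  have he0 : e ≠ 0 := (zero_le.trans_lt hse).ne'
  have hBe : B < ω ^ e := hBs.trans ((opow_lt_opow_iff_right one_lt_omega0).2 hse)
  have hea : ω ^ e < ω ^ d := (opow_lt_opow_iff_right one_lt_omega0).2 hed
  have hpe : IsPrincipal (· + ·) (ω ^ e) := isPrincipal_add_omega0_opow e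
  have hMe : M < ω ^ e := hMB.trans_lt hBe
  generalize hA : (ω ^ d : Ordinal.{u}) = a at *
  generalize hR : (ω ^ e : Ordinal.{u}) = r at *
  have hlow : ∀ z ∈ Z, z < a → z < r := fun z hz hza =>
    ((hb2 z hza).trans (hB z hz hza)).trans_lt hBe
  have hself : ∀ z < x, z ≠ 0 → Lt1 a (a + z) := fun z hz hz0 => by
    have := ih z hz d hd hz0 (by rw [hA]; exact hz.le.trans hxd) ((opow_dvd_opow _ hz.le).trans hdvd)
    rwa [hA] at this
  have hself' : ∀ z ≤ M, z ≠ 0 → Lt1 r (r + z) := fun z hz hz0 => by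
    have := ih z (hz.trans_lt hMx) e he0 hz0 (by rw [hR]; exact hz.trans hMe.le)
      ((opow_dvd_opow _ hz).trans hdvde)
    rwa [hR] at this
  have hcase : ∀ z ∈ Z, z < a ∨ ∃ y ≤ M, y < x ∧ z = a + y := by
    intro z hz
    rcases lt_or_ge z a with h | h
    · exact Or.inl h
    · exact Or.inr ⟨z - a, hM z hz, (hM z hz).trans_lt hMx, (Ordinal.add_sub_cancel_of_le h).symm⟩
  have hna : ∀ y, ¬ a + y < a := fun y => not_lt.2 le_self_add
  refine ⟨fun z => if z < a then z else r + (z - a), fun z hz => ?_, fun z hz hza => if_pos hza,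
    fun z hz w hw => ?_, fun z hz w hw v hv => ?_, fun z hz w hw => ?_⟩
  · rcases hcase z hz with h | ⟨y, hyM, hyx, rfl⟩
    · simp [h]
    · simpa using hpa hea ((hyM.trans_lt hMe).trans hea)
  · rcases hcase z hz with h | ⟨y, hyM, hyx, rfl⟩ <;> rcases hcase w hw with h' | ⟨y', hyM', hyx', rfl⟩
    · simp [h, h']
    · simp [h, h.trans_le (le_self_add : a ≤ a + y'), (hlow z hz h).trans_le (le_self_add : r ≤ r + y')]
    · simp [h', (h'.trans_le (le_self_add : a ≤ a + y)).not_gt,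
        ((hlow w hw h').trans_le (le_self_add : r ≤ r + y)).not_gt]
    · simp
  · rcases hcase z hz with h | ⟨y, hyM, hyx, rfl⟩ <;>
      rcases hcase w hw with h' | ⟨y', hyM', hyx', rfl⟩ <;>
      rcases hcase v hv with h'' | ⟨y'', hyM'', hyx'', rfl⟩
    · simp [h, h', h'']
    · have h1 := hpa h h'
      have h2 := hpe (hlow z hz h) (hlow w hw h')
      simpa [h, h', (h1.trans_le le_self_add).ne] using (h2.trans_le le_self_add).ne
    · have h1 : v < z + (a + y') := h''.trans_le (le_self_add.trans le_add_self)
      have h2 : v < z + (r + y') := (hlow v hv h'').trans_le (le_self_add.trans le_add_self)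
      simp [h, h'', h1.ne', h2.ne']
    · simp [h, ← add_assoc, hpa.add_eq_right h, hpe.add_eq_right (hlow z hz h)]
    · have h1 : v < a + y + w := h''.trans_le (le_self_add.trans le_self_add)
      have h2 : v < r + y + w := (hlow v hv h'').trans_le (le_self_add.trans le_self_add)
      simp [h', h'', h1.ne', h2.ne']
    · simp [h', add_assoc]
    · have h1 : v < a + y + (a + y') := h''.trans_le (le_self_add.trans le_self_add)
      have h2 : v < r + y + (r + y') := (hlow v hv h'').trans_le (le_self_add.trans le_self_add)
      simp [h'', h1.ne', h2.ne']
    · have h1 : y'' < y + (a + y') :=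
        (hyx''.trans_le hxd).trans_le (le_self_add.trans le_add_self)
      have h2 : y'' < y + (r + y') :=
        (hyM''.trans_lt hMe).trans_le (le_self_add.trans le_add_self)
      simp [add_assoc, h1.ne', h2.ne']
  · rcases hcase z hz with h | ⟨y, hyM, hyx, rfl⟩ <;> rcases hcase w hw with h' | ⟨y', hyM', hyx', rfl⟩
    · simp [h, h']
    · simp only [h, if_true, hna, if_false, Ordinal.add_sub_cancel]
      constructor
      · intro hl
        exact hl.mono ((hlow z hz h).trans_le le_self_add) (by gcongr)
      · intro hl
        -- As r exceeds the bound for z, being `<₁`-below r + y' already forces z <₁ a.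
        have hza : Lt1 z a := (hb3 z h _ hl).resolve_right
          (not_le.2 (((hB z hz h).trans_lt hBe).trans_le le_self_add))
        rcases eq_or_ne y' 0 with rfl | hy'
        · simpa using hza
        · exact hza.trans (hself y' hyx' hy')
    · simp only [h', if_true, hna, if_false, Ordinal.add_sub_cancel]
      exact iff_of_false (fun hl => hl.lt.not_gt (h'.trans_le le_self_add))
        (fun hl => hl.lt.not_gt ((hlow w hw h').trans_le le_self_add))
    · simp only [hna, if_false, Ordinal.add_sub_cancel]
      rcases eq_or_ne y 0 with rfl | hy
      · simp only [add_zero]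
        rcases eq_or_ne y' 0 with rfl | hy'
        · exact iff_of_false (fun hl => hl.lt.ne (by simp)) (fun hl => hl.lt.ne (by simp))
        · exact iff_of_true (hself y' hyx' hy') (hself' y' hyM' hy')
      · exact iff_of_false (not_lt1_add hy (hyx.trans_le hxd))
          (not_lt1_add hy (hyM.trans_lt hMe))

theorem lt1_add_self_of_mem_Cl_one {a : Ordinal.{u}} (h : a ∈ Cl.{u} 1) : Lt1 a (a + a) := by
  have h' : ω ^ a = a := h
  have h0 : a ≠ 0 := by
    rintro rfl
    simp at h'
  have := lt1_of_opow_dvd a a h0 h0 h'.ge (by rw [h'])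
  rwa [h'] at this

/-! ### Closing off: unboundedly many d with d <₁ x for all x > d -/

/-- The isomorphism type over `g` of a finite sequence of ordinals, for `<`, `+` and `<₁`. -/
noncomputable def seqType (g : Ordinal.{u}) (v : Σ n : ℕ, Fin n → Ordinal.{u}) :
    Σ n : ℕ, (Fin n → Set.Iic g) × Set (Fin n × Fin n) × Set (Fin n × Fin n × Fin n) ×
      Set (Fin n × Fin n) :=
  ⟨v.1, fun i => ⟨min (v.2 i) g, Set.mem_Iic.2 (min_le_right _ _)⟩, {p | v.2 p.1 < v.2 p.2},
    {p | v.2 p.1 + v.2 p.2.1 = v.2 p.2.2}, {p | Lt1 (v.2 p.1) (v.2 p.2)}⟩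

/-- Only set-many types over g exist, so chosen representatives are bounded. Truncation at g makes a
type record the entries below g exactly. -/
theorem exists_bound_seqType (g : Ordinal.{u}) :
    ∃ g' : Ordinal.{u}, g < g' ∧ ∀ v : Σ n : ℕ, Fin n → Ordinal.{u},
      ∃ w : Fin v.1 → Ordinal.{u}, seqType g v = seqType g ⟨v.1, w⟩ ∧ ∀ i, w i < g' := by
  classical
  let s := Function.surjInv (Set.rangeFactorization_surjective (f := seqType g))
  have hs : ∀ d, seqType g (s d) = d := fun d =>
    congrArg Subtype.val (Function.surjInv_eq (Set.rangeFactorization_surjective (f := seqType g)) d)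
  let b : Set.range (seqType g) → Ordinal.{u} := fun d =>
    Finset.univ.sup fun i => (s d).2 i + 1
  refine ⟨max (g + 1) (⨆ d, b d), (lt_add_one g).trans_le (le_max_left _ _), fun v => ?_⟩
  have h1 := hs ⟨seqType g v, v, rfl⟩
  have h2 : ∀ i, (s ⟨seqType g v, v, rfl⟩).2 i < max (g + 1) (⨆ d, b d) := by
    intro i
    refine (lt_add_one _).trans_le (le_trans ?_ (le_max_right _ _))
    refine le_trans ?_ (le_ciSup (f := b) bddAbove_of_small ⟨seqType g v, v, rfl⟩)
    exact Finset.le_sup (f := fun i => (s ⟨seqType g v, v, rfl⟩).2 i + 1) (Finset.mem_univ i)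
  generalize s ⟨seqType g v, v, rfl⟩ = w at h1 h2
  obtain ⟨n, w⟩ := w
  obtain ⟨n', v⟩ := v
  obtain rfl : n = n' := congrArg Sigma.fst h1
  exact ⟨w, h1.symm, h2⟩

theorem exists_gt_lt1_of_gt (r : Ordinal.{u}) :
    ∃ d, r < d ∧ ∀ x, d < x → Lt1 d x := by
  classical
  choose f hf1 hf2 using exists_bound_seqType.{u}
  let c : ℕ → Ordinal.{u} := fun n => f^[n] r
  have hc : ∀ n, c (n + 1) = f (c n) := fun n => Function.iterate_succ_apply' f n r
  have hmono : StrictMono c := strictMono_nat_of_lt_succ fun n => by rw [hc]; exact hf1 _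
  have hle : ∀ n, c n ≤ ⨆ n, c n := le_ciSup bddAbove_of_small
  have hltd : ∀ n, c n < ⨆ n, c n := fun n => (hmono n.lt_succ_self).trans_le (hle _)
  -- The limit d of the iterates works: the part of Z below d lies below some c N, and the type of Z
  -- over c N is realised below c (N + 1).
  refine ⟨⨆ n, c n, hltd 0, fun x hx => ?_⟩
  rw [lt1_iff]
  refine ⟨hx, fun Z hZ => ?_⟩
  obtain ⟨N, hN⟩ : ∃ N, ∀ z ∈ Z, z < (⨆ n, c n) → z < c N := by
    have : ∀ z, ∃ n, z < (⨆ n, c n) → z < c n := by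
      intro z
      by_cases hz : z < ⨆ n, c n
      · obtain ⟨n, hn⟩ := (lt_ciSup_iff' bddAbove_of_small).1 hz
        exact ⟨n, fun _ => hn⟩
      · exact ⟨0, fun h => absurd h hz⟩
    choose k hk using this
    exact ⟨Z.sup k, fun z hz hzd => (hk z hzd).trans_le (hmono.monotone (Finset.le_sup hz))⟩
  obtain ⟨w, hw, hwlt⟩ := hf2 (c N) ⟨Z.card, fun i => (Z.equivFin.symm i : Ordinal.{u})⟩
  have hw := eq_of_heq (Sigma.mk.inj hw).2
  simp only [Prod.mk.injEq, Set.ext_iff, Set.mem_ofPred_eq, Prod.forall, funext_iff,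
    Subtype.mk.injEq] at hw
  obtain ⟨e0, e1, e2, e3⟩ := hw
  have key : ∀ z, ∀ hz : z ∈ Z, ∃ i, (Z.equivFin.symm i : Ordinal.{u}) = z ∧
      (if hz : z ∈ Z then w (Z.equivFin ⟨z, hz⟩) else 0) = w i := by
    intro z hz
    exact ⟨Z.equivFin ⟨z, hz⟩, by simp, by simp [hz]⟩
  refine ⟨fun z => if hz : z ∈ Z then w (Z.equivFin ⟨z, hz⟩) else 0, fun z hz => ?_,
    fun z hz hzd => ?_, fun x hx y hy => ?_, fun x hx y hy z hz => ?_, fun x hx y hy => ?_⟩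
  · obtain ⟨i, hi, hi'⟩ := key z hz
    simp only [hi']
    exact (hwlt i).trans_le ((hc N).symm.trans_le (hle _))
  · obtain ⟨i, hi, hi'⟩ := key z hz
    simp only [hi']
    have h1 := e0 i
    have h2 := hN z hz hzd
    rw [hi, min_eq_left h2.le] at h1
    rcases min_choice (w i) (c N) with h | h
    · rw [h1, h]
    · exact absurd (h1.trans h) h2.ne
  · obtain ⟨i, hi, hi'⟩ := key x hx
    obtain ⟨j, hj, hj'⟩ := key y hy
    simp only [hi', hj']
    rw [← hi, ← hj]
    exact e1 i j
  · obtain ⟨i, hi, hi'⟩ := key x hx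
    obtain ⟨j, hj, hj'⟩ := key y hy
    obtain ⟨k, hk, hk'⟩ := key z hz
    simp only [hi', hj', hk']
    rw [← hi, ← hj, ← hk]
    exact e2 i j k
  · obtain ⟨i, hi, hi'⟩ := key x hx
    obtain ⟨j, hj, hj'⟩ := key y hy
    simp only [hi', hj']
    rw [← hi, ← hj]
    exact e3 i j

/-! ### The classes Class(n) and `<₁` -/

theorem next_eq_coe {C : Set Ordinal.{u}} {a b : Ordinal.{u}} (h : next C a = b) :
    b ∈ C ∧ a < b ∧ ∀ c ∈ C, a < c → b ≤ c := by
  unfold next at h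
  split_ifs at h with hne
  · obtain rfl := WithTop.coe_injective h
    have hmem := csInf_mem hne
    exact ⟨hmem.1, hmem.2, fun c hc hac => csInf_le' ⟨hc, hac⟩⟩
  · exact absurd h.symm (WithTop.coe_ne_top)

theorem exists_next_eq_coe {C : Set Ordinal.{u}} {a c : Ordinal.{u}} (hc : c ∈ C) (h : a < c) :
    ∃ b : Ordinal.{u}, next C a = b :=
  ⟨_, if_pos ⟨c, hc, h⟩⟩

theorem mem_Cl_add_two {n : ℕ} {a b : Ordinal.{u}} (ha : a ∈ Cl.{u} (n + 1))
    (hb : b ∈ Cl.{u} (n + 1)) (h : Lt1 a b) : a ∈ Cl.{u} (n + 2) := by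
  obtain ⟨c, hc⟩ := exists_next_eq_coe hb h.lt
  obtain ⟨h1, h2, h3⟩ := next_eq_coe hc
  exact ⟨ha, c, hc, h1, h.mono h2 (h3 b hb h.lt)⟩

theorem mem_Cl_one_of_lt1 {a b : Ordinal.{u}} (h : Lt1 a b) (hb : IsPrincipal (· + ·) b) :
    a ∈ Cl.{u} 1 := by
  refine mem_Cl_one_of_lt1_add_self (h.mono ?_ (hb h.lt h.lt).le)
  simpa using zero_lt_one.trans h.one_lt

theorem isPrincipal_of_mem_Cl_one {a : Ordinal.{u}} (h : a ∈ Cl.{u} 1) :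
    IsPrincipal (· + ·) a := by
  have h' : ω ^ a = a := h
  rw [← h']
  exact isPrincipal_add_omega0_opow a

theorem mem_Cl_of_lt1 {n : ℕ} : ∀ {a b : Ordinal.{u}}, b ∈ Cl.{u} (n + 1) → Lt1 a b →
    a ∈ Cl.{u} (n + 2) := by
  induction n with
  | zero =>
    intro a b hb h
    exact mem_Cl_add_two (mem_Cl_one_of_lt1 h (isPrincipal_of_mem_Cl_one hb)) hb h
  | succ n ih =>
    intro a b hb h
    exact mem_Cl_add_two (ih hb.1 h) hb h

theorem exists_gt_mem_Cl (n : ℕ) : ∀ r : Ordinal.{u}, ∃ d, r < d ∧ d ∈ Cl.{u} (n + 1) := by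
  induction n with
  | zero =>
    intro r
    obtain ⟨d, hrd, hd⟩ := exists_gt_lt1_of_gt r
    refine ⟨d, hrd, mem_Cl_one_of_lt1_add_self (hd _ ?_)⟩
    simpa using zero_le.trans_lt hrd
  | succ n ih =>
    intro r
    obtain ⟨d, hrd, hd⟩ := exists_gt_lt1_of_gt r
    obtain ⟨e, hde, he⟩ := ih d
    exact ⟨d, hrd, mem_Cl_of_lt1 he (hd e hde)⟩

theorem lt_of_lt_plus {k : ℕ} {a b t : Ordinal.{u}} (ht : (t : WithTop Ordinal.{u}) < plus k a)
    (hb : b ∈ Cl.{u} k) (hab : a < b) : t < b := by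
  obtain ⟨c, hc⟩ := exists_next_eq_coe hb hab
  rw [plus, hc] at ht
  exact (WithTop.coe_lt_coe.1 ht).trans_le ((next_eq_coe hc).2.2 b hb hab)

/-! ### The function m and the set `P` -/

theorem coe_le_m_iff {r x : Ordinal.{u}} (h : r ≤ x) :
    (x : WithTop Ordinal.{u}) ≤ m r ↔ Le1 r x := by
  have hmono : ∀ y, Le1 r y → x ≤ y → Le1 r x := by
    intro y hy hxy
    rcases h.eq_or_lt with h | h
    · exact Or.inl h
    · rcases hy with rfl | hy
      · exact absurd h hxy.not_gt
      · exact Or.inr (hy.mono h hxy)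
  by_cases hb : BddAbove {ξ | Le1 r ξ}
  · obtain ⟨μ, hμ, hμ1, hμ2⟩ := isGreatest_m r hb
    rw [hμ, WithTop.coe_le_coe]
    exact ⟨hmono μ hμ1, fun hx => hμ2 hx⟩
  · have hm : m r = ⊤ := if_neg hb
    simp only [hm, le_top, true_iff]
    obtain ⟨y, hy, hxy⟩ := not_bddAbove_iff.1 hb x
    exact hmono y hy hxy.le

theorem coe_le_m_self (r : Ordinal.{u}) : (r : WithTop Ordinal.{u}) ≤ m r :=
  (coe_le_m_iff le_rfl).2 (Or.inl rfl)

theorem m_ne_top {k : ℕ} {a r t : Ordinal.{u}}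
    (ht : (t : WithTop Ordinal.{u}) < plus (k + 1) a) (hr : r ∈ Set.Ioc a t) : m r ≠ ⊤ := by
  intro hm
  obtain ⟨b, hrb, hb⟩ := exists_gt_mem_Cl k r
  have h : Le1 r b := (coe_le_m_iff hrb.le).1 (hm ▸ le_top)
  have h' := mem_Cl_of_lt1 hb (h.resolve_left hrb.ne)
  exact (lt_of_lt_plus ht h'.1 hr.1).not_ge hr.2

theorem le1_of_mem_P {a r t : Ordinal.{u}} (h : r ∈ P a t) : Le1 r t :=
  (coe_le_m_iff h.1.2).1 h.2

theorem exists_mem_Cl_of_card {a t : Ordinal.{u}} (n : ℕ) : ∀ S : Finset Ordinal.{u},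
    (∀ r ∈ S, r ∈ P a t) → S.card = n + 3 →
    ∃ r ∈ S, (∀ s ∈ S, r ≤ s) ∧ r ∈ Cl.{u} (n + 1) := by
  classical
  have hlt : ∀ r ∈ P a t, ∀ s ∈ P a t, r < s → Lt1 r s := fun r hr s hs hrs =>
    ((le1_of_mem_P hr).resolve_left (hrs.trans_le hs.1.2).ne).mono hrs hs.1.2
  induction n with
  | zero =>
    intro S hS hc
    have hne : S.Nonempty := Finset.card_pos.1 (by omega)
    have hne' : (S.erase (S.min' hne)).Nonempty :=
      Finset.card_pos.1 (by rw [Finset.card_erase_of_mem (S.min'_mem hne)]; omega)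
    set x := S.min' hne with hx
    have hy := Finset.min'_mem _ hne'
    have hne'' : ((S.erase x).erase ((S.erase x).min' hne')).Nonempty :=
      Finset.card_pos.1 (by
        rw [Finset.card_erase_of_mem hy, Finset.card_erase_of_mem (S.min'_mem hne)]; omega)
    obtain ⟨z, hz⟩ := hne''
    set y := (S.erase x).min' hne' with hy'
    have hyS := (Finset.mem_erase.1 hy).2
    have hzS := (Finset.mem_erase.1 (Finset.mem_erase.1 hz).2).2
    have hxy : x < y := lt_of_le_of_ne (S.min'_le y hyS) (Finset.mem_erase.1 hy).1.symm
    have hyz : y < z := lt_of_le_of_ne ((S.erase x).min'_le z (Finset.mem_erase.1 hz).2)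
      (Finset.mem_erase.1 hz).1.symm
    have hxS := S.min'_mem hne
    exact ⟨x, hxS, fun s hs => S.min'_le s hs,
      mem_Cl_one_of_lt1 (hlt x (hS x hxS) y (hS y hyS) hxy)
        (hlt y (hS y hyS) z (hS z hzS) hyz).isPrincipal⟩
  | succ n ih =>
    intro S hS hc
    have hne : S.Nonempty := Finset.card_pos.1 (by omega)
    have hxS := S.min'_mem hne
    obtain ⟨y, hy, -, hyC⟩ := ih (S.erase (S.min' hne))
      (fun r hr => hS r (Finset.mem_erase.1 hr).2)
      (by rw [Finset.card_erase_of_mem hxS]; omega)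
    have hyS := (Finset.mem_erase.1 hy).2
    exact ⟨_, hxS, fun s hs => S.min'_le s hs, mem_Cl_of_lt1 hyC
      (hlt _ (hS _ hxS) y (hS y hyS)
        (lt_of_le_of_ne (S.min'_le y hyS) (Finset.mem_erase.1 hy).1.symm))⟩

theorem card_le_of_subset_P {k : ℕ} {a t : Ordinal.{u}}
    (ht : (t : WithTop Ordinal.{u}) < plus (k + 1) a) (S : Finset Ordinal.{u})
    (hS : ∀ r ∈ S, r ∈ P a t) : S.card ≤ k + 2 := by
  by_contra hc
  -- The class index here is k + 1: two elements at the top of the chain supply principality, and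
  -- the (k+1)-st below them is in Class(k+1).
  obtain ⟨T, hT, hTc⟩ := Finset.exists_subset_card_eq (n := k + 3) (s := S) (by omega)
  obtain ⟨r, hr, -, hrC⟩ := exists_mem_Cl_of_card k T (fun r hr => hS r (hT hr)) hTc
  have hrP := hS r (hT hr)
  exact (lt_of_lt_plus ht hrC hrP.1.1).not_ge hrP.1.2

theorem finite_P {k : ℕ} {a t : Ordinal.{u}}
    (ht : (t : WithTop Ordinal.{u}) < plus (k + 1) a) : (P a t).Finite := by
  by_contra hinf
  obtain ⟨S, hS, hc⟩ := Set.Infinite.exists_subset_card_eq hinf (k + 3)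
  have := card_le_of_subset_P ht S (fun r hr => hS hr)
  omega

theorem self_mem_P {a t : Ordinal.{u}} (h : a < t) : t ∈ P a t :=
  ⟨⟨h, le_rfl⟩, coe_le_m_self t⟩

theorem exists_isGreatest_m_image {k : ℕ} {a t : Ordinal.{u}} (h : a < t)
    (ht : (t : WithTop Ordinal.{u}) < plus (k + 1) a) :
    ∃ μ : Ordinal.{u}, IsGreatest (m '' P a t) (μ : WithTop Ordinal.{u}) ∧
      IsGreatest (m '' Set.Ioc a t) (μ : WithTop Ordinal.{u}) := by
  obtain ⟨r, hr, hmax⟩ := Set.exists_max_image (P a t) m (finite_P ht) ⟨t, self_mem_P h⟩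
  obtain ⟨μ, hμ⟩ := WithTop.ne_top_iff_exists.1 (m_ne_top ht hr.1)
  refine ⟨μ, ⟨⟨r, hr, hμ.symm⟩, ?_⟩, ⟨r, hr.1, hμ.symm⟩, ?_⟩
  · rintro _ ⟨s, hs, rfl⟩
    exact hμ ▸ hmax s hs
  · rintro _ ⟨s, hs, rfl⟩
    rw [hμ]
    rcases le_or_gt (t : WithTop Ordinal.{u}) (m s) with hts | hts
    · exact hmax s ⟨hs, hts⟩
    · exact hts.le.trans hr.2

/-! ### Towers of successors and the bound m(t) ≤ γ·2 -/

theorem IsTower.unique {n : ℕ} : ∀ {a b c : Ordinal.{u}}, IsTower n a b → IsTower n a c →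
    b = c := by
  induction n with
  | zero =>
    intro a b c hb hc
    exact (show b = a from hb).trans (show c = a from hc).symm
  | succ n ih =>
    rintro a b c ⟨-, g, hg, hb⟩ ⟨-, g', hg', hc⟩
    obtain rfl : g = g' := WithTop.coe_injective (hg.symm.trans hg')
    exact ih hb hc

theorem exists_isTower {n : ℕ} : ∀ {a : Ordinal.{u}}, a ∈ Cl.{u} (n + 1) → ∃ g, IsTower n a g := by
  induction n with
  | zero => exact fun {a} _ => ⟨a, rfl⟩
  | succ n ih =>
    rintro a ⟨ha, b, hb, hbC, -⟩
    obtain ⟨g, hg⟩ := ih hbC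
    exact ⟨g, ha, b, hb, hg⟩

theorem IsTower.le {n : ℕ} : ∀ {a g : Ordinal.{u}}, IsTower n a g → a ≤ g := by
  induction n with
  | zero => exact fun {a g} h => (show g = a from h).ge
  | succ n ih =>
    rintro a g ⟨-, b, hb, h⟩
    exact (next_eq_coe hb).2.1.le.trans (ih h)

/-- Z consists of the tower and g + g. The relation g <₁ g + g makes the image of g an epsilon
number, and each `<₁` up the tower raises the class by one. -/
theorem IsTower.exists_finset_forces_mem_Cl {n : ℕ} : ∀ {a g : Ordinal.{u}}, a ∈ Cl.{u} (n + 1) →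
    IsTower n a g → ∃ Z : Finset Ordinal.{u}, a ∈ Z ∧ (∀ z ∈ Z, z ≤ g + g) ∧
      ∀ h : Ordinal.{u} → Ordinal.{u},
        (∀ x ∈ Z, ∀ y ∈ Z, ∀ z ∈ Z, (x + y = z ↔ h x + h y = h z)) →
        (∀ x ∈ Z, ∀ y ∈ Z, (Lt1 x y ↔ Lt1 (h x) (h y))) → h a ∈ Cl.{u} (n + 1) := by
  classical
  induction n with
  | zero =>
    intro a g ha hg
    obtain rfl : g = a := hg
    refine ⟨{g, g + g}, by simp, by simp, fun h h1 h2 => ?_⟩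
    have h3 := (h2 g (by simp) (g + g) (by simp)).1 (lt1_add_self_of_mem_Cl_one ha)
    rw [← (h1 g (by simp) g (by simp) (g + g) (by simp)).1 rfl] at h3
    exact mem_Cl_one_of_lt1_add_self h3
  | succ n ih =>
    rintro a g ⟨ha, b, hb, hbC, hab⟩ hg
    have hag := hg.le
    obtain ⟨-, b', hb', hg⟩ := hg
    obtain rfl : b = b' := WithTop.coe_injective (hb.symm.trans hb')
    obtain ⟨Z, hbZ, hZ, hf⟩ := ih hbC hg
    refine ⟨insert a Z, by simp, ?_, fun h h1 h2 => ?_⟩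
    · intro z hz
      rcases Finset.mem_insert.1 hz with rfl | hz
      · exact hag.trans le_self_add
      · exact hZ z hz
    · refine mem_Cl_of_lt1 (hf h (fun x hx y hy z hz => h1 x (by simp [hx]) y (by simp [hy]) z
        (by simp [hz])) (fun x hx y hy => h2 x (by simp [hx]) y (by simp [hy]))) ?_
      exact (h2 a (by simp) b (by simp [hbZ])).1 hab

/-- With b the first successor: t < b would put t in the class of b, against minimality; t = b would
reflect to a smaller member above a; t > b is the inductive case. The bound g + g + 1 is what admits
g + g into the reflected set. -/
theorem IsTower.not_lt1 {n : ℕ} : ∀ {a g t : Ordinal.{u}}, a ∈ Cl.{u} (n + 1) →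
    IsTower n a g → a < t → t ≤ g + g → ¬ Lt1 t (g + g + 1) := by
  classical
  induction n with
  | zero =>
    intro a g t ha hg hat htg hlt
    obtain rfl : g = a := hg
    have h1 : t - g ≤ g := Ordinal.sub_le.2 htg
    have h2 := hlt.isPrincipal hat (h1.trans_lt hat)
    exact h2.ne (Ordinal.add_sub_cancel_of_le hat.le)
  | succ n ih =>
    rintro a g t ⟨ha, b, hb, hbC, hab⟩ ⟨-, b', hb', hg⟩ hat htg hlt
    obtain rfl : b = b' := WithTop.coe_injective (hb.symm.trans hb')
    obtain ⟨-, -, hmin⟩ := next_eq_coe hb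
    have hbg : b < g + g + 1 := Order.lt_add_one_iff.2 (hg.le.trans le_self_add)
    rcases lt_trichotomy t b with htb | rfl | htb
    · exact htb.not_ge (hmin t (mem_Cl_of_lt1 hbC (hlt.mono htb hbg.le)).1 hat)
    · obtain ⟨Z, hbZ, hZ, hf⟩ := hg.exists_finset_forces_mem_Cl hbC
      rw [lt1_iff] at hlt
      obtain ⟨h, h1, h2, h3, h4, h5⟩ := hlt.2 (insert a Z) (by
        intro z hz
        rcases Finset.mem_insert.1 hz with rfl | hz
        · exact hat.trans hbg
        · exact Order.lt_add_one_iff.2 (hZ z hz))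
      have hC := hf h (fun x hx y hy z hz => h4 x (by simp [hx]) y (by simp [hy]) z
        (by simp [hz])) (fun x hx y hy => h5 x (by simp [hx]) y (by simp [hy]))
      have h6 := (h3 a (by simp) t (by simp [hbZ])).1 hat
      rw [h2 a (by simp) hat] at h6
      exact (h1 t (by simp [hbZ])).not_ge (hmin _ hC h6)
    · exact ih hbC hg htb htg hlt

theorem IsTower.m_le {n : ℕ} {a g t : Ordinal.{u}} (ha : a ∈ Cl.{u} (n + 1)) (hg : IsTower n a g)
    (hat : a < t) (htg : t ≤ g * 2) : m t ≤ (g * 2 : Ordinal.{u}) := by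
  rw [Ordinal.mul_two] at *
  have hlt : t < g + g + 1 := Order.lt_add_one_iff.2 htg
  have h : m t < (g + g + 1 : Ordinal.{u}) := by
    rw [← not_le, coe_le_m_iff hlt.le]
    rintro (h | h)
    · exact hlt.ne h
    · exact hg.not_lt1 ha hat htg h
  obtain ⟨μ, hμ⟩ := WithTop.ne_top_iff_exists.1 h.ne_top
  rw [← hμ] at h ⊢
  exact WithTop.coe_le_coe.2 (Order.lt_add_one_iff.1 (WithTop.coe_lt_coe.1 h))

end Carlson

theorem mainTheorem12 (k : ℕ) (hk : 1 ≤ k) (α t : Ordinal.{u}) (hα : α ∈ Carlson.Cl k)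
    (hαt : α < t) (ht : (t : WithTop Ordinal.{u}) < Carlson.plus k α) :
    ((Carlson.P α t).Finite ∧ 1 ≤ (Carlson.P α t).ncard ∧ (Carlson.P α t).ncard ≤ k + 1) ∧
    (∃ μ : Ordinal.{u},
      IsGreatest (Carlson.m '' Carlson.P α t) (μ : WithTop Ordinal.{u}) ∧
      IsGreatest (Carlson.m '' Set.Ioc α t) (μ : WithTop Ordinal.{u})) ∧
    (∃! v : Ordinal.{u}, Carlson.IsEta k α t v) ∧
    (∀ v : Ordinal.{u}, Carlson.IsEta k α t v →
      Carlson.m t ≤ (v : WithTop Ordinal.{u}) ∧ (t : WithTop Ordinal.{u}) ≤ Carlson.m t) := by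
  obtain ⟨n, rfl⟩ : ∃ n, k = n + 1 := ⟨k - 1, by omega⟩
  have hfin := Carlson.finite_P ht
  obtain ⟨μ, hμ, hμ'⟩ := Carlson.exists_isGreatest_m_image hαt ht
  refine ⟨⟨hfin, ?_, ?_⟩, ⟨μ, hμ, hμ'⟩, ?_, ?_⟩
  · exact (Set.ncard_pos hfin).2 ⟨t, Carlson.self_mem_P hαt⟩
  · rw [Set.ncard_eq_toFinset_card _ hfin]
    exact Carlson.card_le_of_subset_P ht _ fun r hr => hfin.mem_toFinset.1 hr
  · obtain ⟨γ, hγ⟩ := Carlson.exists_isTower hα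
    rcases le_or_gt t (γ * 2) with htγ | htγ
    · refine ⟨γ * 2, ⟨γ, hγ, Or.inl ⟨htγ, rfl⟩⟩, ?_⟩
      rintro v ⟨γ', hγ', ⟨-, rfl⟩ | ⟨h, -⟩⟩
      · rw [hγ'.unique hγ]
      · rw [hγ'.unique hγ] at h
        exact absurd h htγ.not_gt
    · refine ⟨μ, ⟨γ, hγ, Or.inr ⟨htγ, hμ'⟩⟩, ?_⟩
      rintro v ⟨γ', hγ', ⟨h, -⟩ | ⟨-, h⟩⟩
      · rw [hγ'.unique hγ] at h
        exact absurd htγ h.not_gt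
      · exact WithTop.coe_injective (h.unique hμ')
  · rintro v ⟨γ, hγ, ⟨htγ, rfl⟩ | ⟨-, h⟩⟩
    · exact ⟨hγ.m_le hα hαt htγ, Carlson.coe_le_m_self t⟩
    · exact ⟨h.2 ⟨t, ⟨hαt, le_rfl⟩, rfl⟩, Carlson.coe_le_m_self t⟩
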